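/- **Conventions.** A multidigraph $D$ consists of a finite vertex set $V(D)$, a finite edge set $E(D)$ and maps $s,t:E(D)\to V(D)$ (source and target). Different edges $e,f$ are parallel if $s(e)=s(f)$ and $t(e)=t(f)$. For $\sigma\subseteq E(D)$, $D[\sigma]$ is the subgraph with edge set $\sigma$ whose vertices are the endpoints of the edges in $\sigma$. It is a *directed cycle* if it is nonempty, connected, without parallel edges, and every vertex of it has in-degree and out-degree $1$. It is a *directed forest* if it has no parallel edges, contains no directed cycle, and no two distinct edges in $\sigma$ have the same target. The *directed tree complex* $\mathrm{DT}(D)$ is the simplicial complex on $E(D)$ whose faces are the $\sigma\subseteq E(D)$ such that $D[\sigma]$ is a directed forest. A *hypergraph* $\mathcal H$ on a vertex set $V(\mathcal H)$ is a set of subsets of $V(\mathcal H)$ (hyperedges), none properly contained in another. For a vertex $v$, the deletion $\mathcal H\setminus v$ and the contraction $\mathcal H/v$ are the hypergraphs on $V(\mathcal H)\setminus\{v\}$ whose hyperedges are, respectively, the hyperedges of $\mathcal H$ not containing $v$, and the inclusion-minimal sets among the sets $a\setminus\{v\}$ with $a$ a hyperedge of $\mathcal H$. A minor of $\mathcal H$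 is a hypergraph obtained from $\mathcal H$ by a (possibly empty) sequence of deletions and contractions. A vertex $v$ is *simplicial* if for any two distinct hyperedges $a,b$ containing $v$ there is a hyperedge $c\subseteq(a\cup b)\setminus\{v\}$. $\mathcal H$ is *W-chordal* if every minor of $\mathcal H$ with nonempty vertex set has a simplicial vertex. The *tree conflict hypergraph* $\mathcal H^{\mathbf t}_D$ has vertex set $E(D)$, and its hyperedges are the sets $\sigma\subseteq E(D)$ for which $D[\sigma]$ is a directed cycle, the pairs $\{e,f\}$ of parallel edges, and the pairs $\{e,f\}$ with $s(e)\ne s(f)$ and $t(e)=t(f)$. (If $D$ has loops, then only the inclusion-minimal ones among these sets are taken; without loops all of them are minimal.) A simplicial complex is *shellable* if its facets can be ordered $\sigma_1,\dots,\sigma_s$ so that for each $2\le i\le s$ the complex $\langle\sigma_i\rangle\cap\langle\sigma_1,\dots,\sigma_{i-1}\rangle$ is pure of dimension $\dim\sigma_i-1$. An edge $e$ of $D$ is a *cycle-piercing edge* if there are a directed cycle $D[\sigma]$ in $D$ and an edge $f\in\sigma$ with $t(e)=t(f)$ and $s(e)\ne s(f)$. **Theorem.** Let $D$ be a multidigraph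 that does not contain any cycle-piercing edge. Then $\mathcal H^{\mathbf t}_D$ is W-chordal, and the directed tree complex $\mathrm{DT}(D)$ is shellable. -/

import Mathlib

/-- A directed multigraph with vertex set `V` and edge set `E`: every edge has a source and a
target.  Parallel edges and loops are allowed. -/
structure Multidigraph (V E : Type*) where
  /-- the source of an edge -/
  src : E → V
  /-- the target of an edge -/
  tgt : E → V

namespace Multidigraph

/-- Two different edges are parallel if they have the same source and the same target. -/
def Parallel {V E : Type*} (D : Multidigraph V E) (e f : E) : Prop :=
  e ≠ f ∧ D.src e = D.src f ∧ D.tgt e = D.tgt f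

/-- The vertex set of the subgraph `D[σ]` induced by a set `σ` of edges: all endpoints of edges
in `σ`. -/
def verts {V E : Type*} (D : Multidigraph V E) (σ : Set E) : Set V :=
  {v | ∃ e ∈ σ, D.src e = v ∨ D.tgt e = v}

/-- The underlying simple graph of `D[σ]`: two different vertices are adjacent if there is an edge
in `σ` from one of them to the other. -/
def underlying {V E : Type*} (D : Multidigraph V E) (σ : Set E) : SimpleGraph (D.verts σ) :=
  SimpleGraph.fromRel fun u v => ∃ e ∈ σ, D.src e = u ∧ D.tgt e = v

/-- The in-degree of a vertex in `D[σ]`. -/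
noncomputable def inDegree {V E : Type*} (D : Multidigraph V E) (σ : Set E) (v : V) : ℕ :=
  {e | e ∈ σ ∧ D.tgt e = v}.ncard

/-- The out-degree of a vertex in `D[σ]`. -/
noncomputable def outDegree {V E : Type*} (D : Multidigraph V E) (σ : Set E) (v : V) : ℕ :=
  {e | e ∈ σ ∧ D.src e = v}.ncard

/-- `D[σ]` is a digraph: it has no parallel edges. -/
def IsDigraph {V E : Type*} (D : Multidigraph V E) (σ : Set E) : Prop :=
  ∀ e ∈ σ, ∀ f ∈ σ, ¬ D.Parallel e f

/-- `D[σ]` is a directed cycle: a connected (in particular nonempty) digraph in which each vertex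
has in-degree and out-degree both equal to `1`. -/
def IsDirectedCycle {V E : Type*} (D : Multidigraph V E) (σ : Set E) : Prop :=
  D.IsDigraph σ ∧ (D.underlying σ).Connected ∧
    ∀ v ∈ D.verts σ, D.inDegree σ v = 1 ∧ D.outDegree σ v = 1

/-- `D[σ]` is a directed forest: a digraph without directed cycles in which no two distinct edges
share the same target. -/
def IsDirectedForest {V E : Type*} (D : Multidigraph V E) (σ : Set E) : Prop :=
  D.IsDigraph σ ∧ (∀ τ ⊆ σ, ¬ D.IsDirectedCycle τ) ∧
    ∀ e ∈ σ, ∀ f ∈ σ, e ≠ f → D.tgt e ≠ D.tgt f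

/-- `e` is a cycle-piercing edge: it has the same target as, but a different source from, some
edge `f` of a directed cycle `D[σ]`. -/
def IsCyclePiercing {V E : Type*} (D : Multidigraph V E) (e : E) : Prop :=
  ∃ σ : Set E, D.IsDirectedCycle σ ∧ ∃ f ∈ σ, D.tgt e = D.tgt f ∧ D.src e ≠ D.src f

end Multidigraph

/-- An abstract simplicial complex on the vertex set `α`, as a collection of finite subsets closed
under passing to subsets.  As is usual in combinatorics, the empty set counts as a face of every
complex other than the void complex, which has no faces; so Mathlib's
`PreAbstractSimplicialComplex`, whose faces are nonempty, is not used. -/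
structure FaceComplex (α : Type*) where
  /-- the faces -/
  faces : Set (Finset α)
  /-- subsets of faces are faces -/
  down_closed : ∀ σ ∈ faces, ∀ τ ⊆ σ, τ ∈ faces

namespace FaceComplex

/-- A facet is an inclusion-maximal face. -/
def IsFacet {α : Type*} (Δ : FaceComplex α) (σ : Finset α) : Prop :=
  Maximal (fun τ => τ ∈ Δ.faces) σ

/-- The dimension `|σ| - 1` of a face. -/
def faceDim {α : Type*} (σ : Finset α) : ℤ := (σ.card : ℤ) - 1

/-- The complex `⟨S⟩` generated by a collection `S` of finite sets: all their subsets. -/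
def generated {α : Type*} (S : Set (Finset α)) : FaceComplex α where
  faces := {τ | ∃ σ ∈ S, τ ⊆ σ}
  down_closed := fun _ ⟨ρ, hρ, h⟩ _ hτ => ⟨ρ, hρ, hτ.trans h⟩

/-- The intersection of two complexes. -/
def inter {α : Type*} (Δ Γ : FaceComplex α) : FaceComplex α where
  faces := Δ.faces ∩ Γ.faces
  down_closed := fun σ h τ hτ => ⟨Δ.down_closed σ h.1 τ hτ, Γ.down_closed σ h.2 τ hτ⟩

/-- `Δ` is pure of dimension `d`: it is not void and all its facets have dimension `d`. -/
def IsPureOfDim {α : Type*} (Δ : FaceComplex α) (d : ℤ) : Prop :=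
  Δ.faces.Nonempty ∧ ∀ σ, Δ.IsFacet σ → faceDim σ = d

/-- `Δ` is shellable (in the not necessarily pure sense): its facets can be listed, without
repetition, as `F 0, …, F (s - 1)` in such a way that for each `i` other than the first one
the complex `⟨F i⟩ ∩ ⟨F 0, …, F (i - 1)⟩` is pure of dimension `dim (F i) - 1`. -/
def IsShellable {α : Type*} (Δ : FaceComplex α) : Prop :=
  ∃ (s : ℕ) (F : Fin s → Finset α), Function.Injective F ∧ Set.range F = {σ | Δ.IsFacet σ} ∧
    ∀ i : Fin s, 0 < (i : ℕ) →
      ((generated {F i}).inter (generated (F '' Set.Iio i))).IsPureOfDim (faceDim (F i) - 1)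

end FaceComplex

/-- A hypergraph no hyperedge of which is properly contained in another one (also called a
clutter). -/
structure SimpleHypergraph (α : Type*) extends Hypergraph α where
  /-- distinct hyperedges are not contained in one another -/
  antichain : IsAntichain (· ⊆ ·) edgeSet

namespace SimpleHypergraph

theorem antichain_setOf_minimal {α : Type*} (S : Set (Set α)) :
    IsAntichain (· ⊆ ·) {e | Minimal (fun a => a ∈ S) e} :=
  fun _ ha _ hb hne hab => hne (hb.eq_of_subset ha.prop hab)

/-- The deletion `H \ v`: discard the vertex `v` and all hyperedges containing it. -/
def delete {α : Type*} (H : SimpleHypergraph α) (v : α) : SimpleHypergraph α where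
  vertexSet := H.vertexSet \ {v}
  edgeSet := {e | e ∈ H.edgeSet ∧ v ∉ e}
  subset_vertexSet_of_mem_edgeSet' := fun _ he =>
    Set.subset_sdiff_singleton (H.subset_vertexSet_of_mem_edgeSet' he.1) he.2
  antichain := H.antichain.subset fun _ he => he.1

/-- The contraction `H / v`: discard the vertex `v`; the hyperedges are the minimal sets among
the `e \ {v}`, where `e` runs over the hyperedges of `H`. -/
def contract {α : Type*} (H : SimpleHypergraph α) (v : α) : SimpleHypergraph α where
  vertexSet := H.vertexSet \ {v}
  edgeSet := {a | Minimal (fun b => b ∈ (fun e => e \ {v}) '' H.edgeSet) a}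
  subset_vertexSet_of_mem_edgeSet' := by
    intro a ha
    obtain ⟨e, he, rfl⟩ := ha.prop
    exact Set.sdiff_subset_sdiff_left (H.subset_vertexSet_of_mem_edgeSet' he)
  antichain := antichain_setOf_minimal _

/-- `IsMinor H' H`: the hypergraph `H'` is obtained from `H` by a (possibly empty) sequence of
deletions and contractions of vertices. -/
inductive IsMinor {α : Type*} : SimpleHypergraph α → SimpleHypergraph α → Prop
  | refl (H : SimpleHypergraph α) : IsMinor H H
  | delete {K H : SimpleHypergraph α} (v : α) (hv : v ∈ K.vertexSet) (h : IsMinor K H) :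
      IsMinor (K.delete v) H
  | contract {K H : SimpleHypergraph α} (v : α) (hv : v ∈ K.vertexSet) (h : IsMinor K H) :
      IsMinor (K.contract v) H

/-- A vertex `v` is simplicial if for every two (distinct) hyperedges `e₁`, `e₂` containing `v`
there is a hyperedge `e₃` contained in `(e₁ ∪ e₂) \ {v}`. -/
def IsSimplicialVertex {α : Type*} (H : SimpleHypergraph α) (v : α) : Prop :=
  v ∈ H.vertexSet ∧ ∀ e₁ ∈ H.edgeSet, ∀ e₂ ∈ H.edgeSet, e₁ ≠ e₂ → v ∈ e₁ → v ∈ e₂ →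
    ∃ e₃ ∈ H.edgeSet, e₃ ⊆ (e₁ ∪ e₂) \ {v}

/-- `H` is W-chordal if every minor of `H` (that has a vertex at all) has a simplicial vertex. -/
def IsWChordal {α : Type*} (H : SimpleHypergraph α) : Prop :=
  ∀ K : SimpleHypergraph α, IsMinor K H → K.vertexSet.Nonempty → ∃ v, K.IsSimplicialVertex v

end SimpleHypergraph

namespace Multidigraph

/-- The directed tree complex `DT(D)`: its faces are the sets `σ` of edges for which `D[σ]` is a
directed forest. -/
def directedTreeComplex {V E : Type*} (D : Multidigraph V E) : FaceComplex E where
  faces := {σ | D.IsDirectedForest (σ : Set E)}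
  down_closed := by
    rintro σ ⟨h1, h2, h3⟩ τ hτ
    have hs : (τ : Set E) ⊆ (σ : Set E) := by exact_mod_cast hτ
    exact ⟨fun e he f hf => h1 e (hs he) f (hs hf), fun ρ hρ => h2 ρ (hρ.trans hs),
      fun e he f hf => h3 e (hs he) f (hs hf)⟩

/-- The forbidden configurations of directed forests: directed cycles, pairs of parallel edges, and
pairs of edges with different sources and the same target. -/
def treeConflicts {V E : Type*} (D : Multidigraph V E) : Set (Set E) :=
  {σ | D.IsDirectedCycle σ} ∪ {σ | ∃ e f, D.Parallel e f ∧ σ = {e, f}} ∪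
    {σ | ∃ e f, D.src e ≠ D.src f ∧ D.tgt e = D.tgt f ∧ σ = {e, f}}

/-- The tree conflict hypergraph of `D`.  Its vertices are the edges of `D` and its hyperedges are
the (minimal) members of `D.treeConflicts`.  If `D` has no loops, then all members of
`D.treeConflicts` are minimal, see `treeConflictHypergraph_edgeSet`; minimality only matters for a
pair of edges one of which is a loop, because the loop alone is already a directed cycle. -/
def treeConflictHypergraph {V E : Type*} (D : Multidigraph V E) : SimpleHypergraph E where
  vertexSet := Set.univ
  edgeSet := {σ | Minimal (fun τ => τ ∈ D.treeConflicts) σ}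
  subset_vertexSet_of_mem_edgeSet' := fun _ _ => Set.subset_univ _
  antichain := SimpleHypergraph.antichain_setOf_minimal _

theorem IsDirectedCycle.eq_of_tgt {V E : Type*} {D : Multidigraph V E} {σ : Set E}
    (h : D.IsDirectedCycle σ) {e f : E} (he : e ∈ σ) (hf : f ∈ σ) (hef : D.tgt e = D.tgt f) :
    e = f := by
  obtain ⟨a, ha⟩ := Set.ncard_eq_one.1 (h.2.2 (D.tgt f) ⟨f, hf, Or.inr rfl⟩).1
  have h1 : e ∈ ({a} : Set E) := ha ▸ ⟨he, hef⟩
  have h2 : f ∈ ({a} : Set E) := ha ▸ ⟨hf, rfl⟩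
  exact h1.trans h2.symm

theorem IsDirectedCycle.eq_of_src {V E : Type*} {D : Multidigraph V E} {σ : Set E}
    (h : D.IsDirectedCycle σ) {e f : E} (he : e ∈ σ) (hf : f ∈ σ) (hef : D.src e = D.src f) :
    e = f := by
  obtain ⟨a, ha⟩ := Set.ncard_eq_one.1 (h.2.2 (D.src f) ⟨f, hf, Or.inl rfl⟩).2
  have h1 : e ∈ ({a} : Set E) := ha ▸ ⟨he, hef⟩
  have h2 : f ∈ ({a} : Set E) := ha ▸ ⟨hf, rfl⟩
  exact h1.trans h2.symm

theorem IsDirectedCycle.exists_tgt {V E : Type*} {D : Multidigraph V E} {σ : Set E}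
    (h : D.IsDirectedCycle σ) {v : V} (hv : v ∈ D.verts σ) : ∃ e ∈ σ, D.tgt e = v := by
  obtain ⟨a, ha⟩ := Set.ncard_eq_one.1 (h.2.2 v hv).1
  have h1 : a ∈ {e | e ∈ σ ∧ D.tgt e = v} := ha ▸ rfl
  exact ⟨a, h1⟩

theorem IsDirectedCycle.exists_src {V E : Type*} {D : Multidigraph V E} {σ : Set E}
    (h : D.IsDirectedCycle σ) {v : V} (hv : v ∈ D.verts σ) : ∃ e ∈ σ, D.src e = v := by
  obtain ⟨a, ha⟩ := Set.ncard_eq_one.1 (h.2.2 v hv).2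
  have h1 : a ∈ {e | e ∈ σ ∧ D.src e = v} := ha ▸ rfl
  exact ⟨a, h1⟩

/-- A directed cycle does not properly contain another one. -/
theorem IsDirectedCycle.eq_of_subset {V E : Type*} {D : Multidigraph V E} {σ τ : Set E}
    (hσ : D.IsDirectedCycle σ) (hτ : D.IsDirectedCycle τ) (h : σ ⊆ τ) : σ = τ := by
  have hsub : D.verts σ ⊆ D.verts τ := fun v ⟨e, he, hv⟩ => ⟨e, h he, hv⟩
  obtain ⟨v, hv⟩ := hσ.2.1.nonempty
  have key : ∀ w : D.verts τ, (D.underlying τ).Reachable ⟨v, hsub hv⟩ w → (w : V) ∈ D.verts σ := by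
    intro w hw
    rw [SimpleGraph.reachable_iff_reflTransGen] at hw
    induction hw with
    | refl => exact hv
    | @tail b c _ hbc ih =>
      rw [underlying, SimpleGraph.fromRel_adj] at hbc
      rcases hbc.2 with ⟨e, he, h1, h2⟩ | ⟨e, he, h1, h2⟩
      · obtain ⟨f, hf, hfb⟩ := hσ.exists_src ih
        have hef : e = f := hτ.eq_of_src he (h hf) (h1.trans hfb.symm)
        exact ⟨f, hf, Or.inr (hef ▸ h2)⟩
      · obtain ⟨f, hf, hfb⟩ := hσ.exists_tgt ih
        have hef : e = f := hτ.eq_of_tgt he (h hf) (h2.trans hfb.symm)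
        exact ⟨f, hf, Or.inl (hef ▸ h1)⟩
  refine h.antisymm fun e he => ?_
  have hw := key ⟨D.tgt e, e, he, Or.inr rfl⟩ (hτ.2.1.preconnected _ _)
  obtain ⟨f, hf, hfe⟩ := hσ.exists_tgt hw
  have hef : e = f := hτ.eq_of_tgt he (h hf) hfe.symm
  exact hef ▸ hf

/-- If `D` has no loops, then the hyperedges of the tree conflict hypergraph are exactly the
directed cycles, the pairs of parallel edges, and the pairs of edges with different sources and the
same target. -/
theorem treeConflictHypergraph_edgeSet {V E : Type*} (D : Multidigraph V E)
    (hD : ∀ e, D.src e ≠ D.tgt e) : D.treeConflictHypergraph.edgeSet = D.treeConflicts := by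
  have hpair : ∀ σ, σ ∈ D.treeConflicts →
      D.IsDirectedCycle σ ∨ ∃ e f, e ≠ f ∧ D.tgt e = D.tgt f ∧ σ = {e, f} := by
    rintro σ ((h | ⟨e, f, h, rfl⟩) | ⟨e, f, h1, h2, rfl⟩)
    · exact Or.inl h
    · exact Or.inr ⟨e, f, h.1, h.2.2, rfl⟩
    · exact Or.inr ⟨e, f, fun h => h1 (h ▸ rfl), h2, rfl⟩
  have hanti : ∀ σ ∈ D.treeConflicts, ∀ τ ∈ D.treeConflicts, σ ⊆ τ → σ = τ := by
    intro σ hσ τ hτ hst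
    rcases hpair σ hσ with hs | ⟨e, f, hne, ht, rfl⟩
    · rcases hpair τ hτ with h | ⟨e, f, hne, ht, rfl⟩
      · exact hs.eq_of_subset h hst
      · exfalso
        obtain ⟨v, a, ha, -⟩ := hs.2.1.nonempty
        obtain ⟨b, hb, hba⟩ := hs.exists_tgt ⟨a, ha, Or.inl rfl⟩
        have hab : D.tgt b = D.tgt a := by
          rcases hst ha with rfl | rfl <;> rcases hst hb with rfl | rfl <;> simp_all
        exact hD a (hba.symm.trans hab)
    · have he : e ∈ τ := hst (by simp)
      have hf : f ∈ τ := hst (by simp)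
      rcases hpair τ hτ with h | ⟨e', f', hne', ht', rfl⟩
      · exact absurd (h.eq_of_tgt he hf ht) hne
      · rcases he with rfl | rfl <;> rcases hf with rfl | rfl <;>
          simp_all [Set.pair_comm]
  ext σ
  exact ⟨fun h => h.prop, fun h => ⟨h, fun τ hτ hts => (hanti τ hτ σ h hts).ge⟩⟩

end Multidigraph

/-! The point is that the tree conflict hypergraph satisfies circuit elimination, like the circuits
of a matroid, with `DT(D)` as independence complex. Elimination survives deletion and contraction,
so in every minor every vertex is simplicial. It also gives basis exchange between facets, and then
a lexicographic order of the facets is a shelling. Elimination at an edge `v` has three cases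
(`treeConflictHypergraph_hasElimination`). Two pairs `{v, g}`, `{v, k}` leave `{g, k}`, whose
members have the target of `v`. Two distinct directed cycles through `v` must enter some vertex by
different edges, and these form a conflicting pair. For a pair `{v, g}` and a cycle through `v`, the
edge `g` does not pierce the cycle, so it is parallel to `v` and can replace it; only this case
needs the hypothesis on `D`. -/

namespace SimpleHypergraph

/-! ### Circuit elimination and minors -/

/-- Circuit elimination: every vertex lying in two hyperedges can be eliminated from their union. -/
def HasElimination {α : Type*} (H : SimpleHypergraph α) : Prop :=
  ∀ a ∈ H.edgeSet, ∀ b ∈ H.edgeSet, a ≠ b → ∀ v ∈ a, v ∈ b →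
    ∃ c ∈ H.edgeSet, c ⊆ (a ∪ b) \ {v}

theorem HasElimination.delete {α : Type*} {H : SimpleHypergraph α} (h : H.HasElimination) (v : α) :
    (H.delete v).HasElimination := by
  rintro a ⟨ha, hva⟩ b ⟨hb, hvb⟩ hab x hxa hxb
  obtain ⟨c, hc, hcs⟩ := h a ha b hb hab x hxa hxb
  refine ⟨c, ⟨hc, fun hvc => ?_⟩, hcs⟩
  rcases (hcs hvc).1 with h | h
  exacts [hva h, hvb h]

/-- Lift both hyperedges to `H`, eliminate there, remove `v`, and shrink to a minimal set, which
exists by finiteness. -/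
theorem HasElimination.contract {α : Type*} [Finite α] {H : SimpleHypergraph α}
    (h : H.HasElimination) (v : α) : (H.contract v).HasElimination := by
  intro a ha b hb hab x hxa hxb
  obtain ⟨a, ha', rfl⟩ := ha.prop
  obtain ⟨b, hb', rfl⟩ := hb.prop
  obtain ⟨c, hc, hcs⟩ := h a ha' b hb' (fun h => hab (h ▸ rfl)) x hxa.1 hxb.1
  obtain ⟨d, hdc, hd⟩ := exists_minimal_le_of_wellFoundedLT
    (fun d => d ∈ (fun e => e \ {v}) '' H.edgeSet) (c \ {v}) ⟨c, hc, rfl⟩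
  refine ⟨d, hd, fun y hy => ?_⟩
  obtain ⟨hyc, hyv⟩ := hdc hy
  obtain ⟨hy1 | hy1, hyx⟩ := hcs hyc
  exacts [⟨Or.inl ⟨hy1, hyv⟩, hyx⟩, ⟨Or.inr ⟨hy1, hyv⟩, hyx⟩]

theorem HasElimination.of_isMinor {α : Type*} [Finite α] {K H : SimpleHypergraph α}
    (h : IsMinor K H) (hH : H.HasElimination) : K.HasElimination := by
  induction h with
  | refl => exact hH
  | delete v _ _ ih => exact (ih hH).delete v
  | contract v _ _ ih => exact (ih hH).contract v

theorem HasElimination.isWChordal {α : Type*} [Finite α] {H : SimpleHypergraph α}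
    (hH : H.HasElimination) : H.IsWChordal := by
  rintro K hK ⟨v, hv⟩
  exact ⟨v, hv, fun a ha b hb hab hva hvb => hH.of_isMinor hK a ha b hb hab v hva hvb⟩

end SimpleHypergraph

/-! ### Basis exchange and lexicographic shelling -/

namespace FaceComplex

section Exchange

variable {α : Type*} [DecidableEq α] {Δ : FaceComplex α} {H : SimpleHypergraph α}

/-- Exchange between two facets of a complex whose minimal non-faces satisfy elimination. -/
theorem IsFacet.exchange (hΔ : ∀ σ : Finset α, σ ∈ Δ.faces ↔ ∀ c ∈ H.edgeSet, ¬ c ⊆ (σ : Set α))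
    (hH : H.HasElimination) {B B' : Finset α} (hB : Δ.IsFacet B) (hB' : Δ.IsFacet B') {x : α}
    (hx : x ∈ B') (hxB : x ∉ B) :
    ∃ y ∈ B, y ∉ B' ∧ Δ.IsFacet (insert x (B.erase y)) := by
  -- Fundamental circuit of `z` with respect to the facet `A`.
  have hcirc : ∀ (A : Finset α) (z : α), Δ.IsFacet A → z ∉ A →
      ∃ c ∈ H.edgeSet, c ⊆ insert z (A : Set α) ∧ z ∈ c := by
    intro A z hA hz
    have h1 : insert z A ∉ Δ.faces := fun h =>
      hz (hA.le_of_ge h (Finset.subset_insert z A) (Finset.mem_insert_self z A))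
    rw [hΔ] at h1
    push Not at h1
    obtain ⟨c, hc, hcs⟩ := h1
    rw [Finset.coe_insert] at hcs
    refine ⟨c, hc, hcs, by_contra fun hzc => (hΔ A).1 hA.prop c hc fun w hw => ?_⟩
    exact (hcs hw).resolve_left fun h => hzc (h ▸ hw)
  obtain ⟨C, hC, hCs, hxC⟩ := hcirc B x hB hxB
  -- Any element of the fundamental circuit `C` of `x` outside `B'` can be traded for `x`.
  obtain ⟨y, hyC, hyB'⟩ := Set.not_subset.1 ((hΔ B').1 hB'.prop C hC)
  have hyx : y ≠ x := fun h => hyB' (h ▸ hx)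
  have hyB : y ∈ B := (hCs hyC).resolve_left hyx
  refine ⟨y, hyB, hyB', (hΔ _).2 fun c hc hcs => ?_, fun σ hσ hle z hz => ?_⟩
  · have hyc : y ∉ c := fun h => by simpa [hyx] using hcs h
    have hcB : c ⊆ insert x (B : Set α) := fun w hw => by
      have := hcs hw
      simp only [Finset.coe_insert, Set.mem_insert_iff, Finset.mem_coe, Finset.mem_erase] at this
      exact this.imp id And.right
    have hxc : x ∈ c := by_contra fun hxc => (hΔ B).1 hB.prop c hc fun w hw =>
      (hcB hw).resolve_left fun h => hxc (h ▸ hw)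
    -- Both circuits pass through `x` and only `C` contains `y`; eliminating `x` leaves a circuit
    -- inside `B`.
    obtain ⟨d, hd, hds⟩ := hH c hc C hC (fun h => hyc (h ▸ hyC)) x hxc hxC
    refine (hΔ B).1 hB.prop d hd fun w hw => ?_
    obtain ⟨h1 | h1, h2⟩ := hds hw
    exacts [(hcB h1).resolve_left h2, (hCs h1).resolve_left h2]
  · by_contra hzn
    have hle' : ∀ w, w = x ∨ w ≠ y ∧ w ∈ B → w ∈ σ := fun w hw => hle (by simpa using hw)
    have hzx : z ≠ x := fun h => hzn (by simp [h])
    by_cases hzy : z = y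
    · refine (hΔ σ).1 hσ C hC fun w hw => ?_
      by_cases hwy : w = y
      · exact hwy ▸ hzy ▸ hz
      · exact hle' w ((hCs hw).imp id fun h => ⟨hwy, h⟩)
    · have hzB : z ∉ B := fun h => hzn (by simp [hzy, h])
      obtain ⟨c, hc, hcs, hzc⟩ := hcirc B z hB hzB
      have hcσ : ∀ w ∈ c, w ≠ y → w ∈ σ := fun w hw hwy => by
        rcases hcs hw with rfl | h
        exacts [hz, hle' w (Or.inr ⟨hwy, h⟩)]
      have hyc : y ∈ c := by_contra fun hyc =>
        (hΔ σ).1 hσ c hc fun w hw => hcσ w hw fun h => hyc (h ▸ hw)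
      have hxc : x ∉ c := fun h => (hcs h).elim (fun h => hzx h.symm) hxB
      -- Maximality: the fundamental circuits of `z` and `x` share `y`; eliminating it leaves a
      -- circuit inside the supposed larger face `σ`.
      obtain ⟨d, hd, hds⟩ := hH c hc C hC (fun h => hxc (h ▸ hxC)) y hyc hyC
      refine (hΔ σ).1 hσ d hd fun w hw => ?_
      obtain ⟨h1 | h1, h2⟩ := hds hw
      exacts [hcσ w h1 h2, hle' w ((hCs h1).imp id fun h => ⟨h2, h⟩)]

end Exchange

/-- A complex whose minimal non-faces satisfy circuit elimination (an independence complex of a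
matroid) is shellable: its facets can be ordered lexicographically. -/
theorem isShellable_of_hasElimination {α : Type*} [Finite α] {Δ : FaceComplex α}
    {H : SimpleHypergraph α}
    (hΔ : ∀ σ : Finset α, σ ∈ Δ.faces ↔ ∀ c ∈ H.edgeSet, ¬ c ⊆ (σ : Set α))
    (hH : H.HasElimination) : Δ.IsShellable := by
  classical
  cases nonempty_fintype α
  let _ : LinearOrder α := LinearOrder.lift' (Fintype.equivFin α) (Fintype.equivFin α).injective
  -- The order dual lists facets in decreasing colexicographic order: earlier facets are
  -- colex-larger.
  let S : Finset (Colex (Finset α))ᵒᵈ :=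
    (Finset.univ.filter fun σ => Δ.IsFacet σ).image fun σ => OrderDual.toDual (toColex σ)
  let e := S.orderIsoOfFin rfl
  let F : Fin S.card → Finset α := fun i => ofColex (OrderDual.ofDual (e i).1)
  have hF : ∀ i, Δ.IsFacet (F i) := fun i => by
    obtain ⟨σ, hσ, h⟩ := Finset.mem_image.1 (e i).2
    have hFi : F i = σ := by simp [F, ← h]
    exact hFi ▸ (Finset.mem_filter.1 hσ).2
  have hlt : ∀ i j, j < i ↔ toColex (F i) < toColex (F j) := fun i j =>
    e.lt_iff_lt.symm
  have hsurj : ∀ σ, Δ.IsFacet σ → ∃ i, F i = σ := fun σ hσ => by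
    obtain ⟨i, hi⟩ := e.surjective ⟨OrderDual.toDual (toColex σ), by simpa [S] using hσ⟩
    exact ⟨i, by simp [F, hi]⟩
  refine ⟨S.card, F, fun i j hij => ?_, ?_, fun i hi => ⟨⟨∅, ?_, ?_⟩, fun σ hσ => ?_⟩⟩
  · by_contra hne
    rcases lt_or_gt_of_ne hne with h | h
    · exact absurd ((hlt _ _).1 h) (by rw [hij]; exact lt_irrefl _)
    · exact absurd ((hlt _ _).1 h) (by rw [hij]; exact lt_irrefl _)
  · ext σ
    exact ⟨fun ⟨i, hi⟩ => hi ▸ hF i, hsurj σ⟩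
  · exact ⟨F i, rfl, Finset.empty_subset _⟩
  · exact ⟨F ⟨0, by omega⟩, ⟨_, Fin.lt_def.2 hi, rfl⟩, Finset.empty_subset _⟩
  · obtain ⟨⟨_, rfl, hσi⟩, ⟨_, ⟨j, hj, rfl⟩, hσj⟩⟩ := hσ.prop
    -- `x` exceeds every element of `F i` outside `F j`, so trading any such `y` for `x` yields an
    -- earlier facet `F k`. It contains `F i` minus `y`, a ridge containing `σ`.
    obtain ⟨x, hxj, hxi, hmax⟩ :=
      Finset.Colex.toColex_lt_toColex_iff_exists_forall_lt.1 ((hlt i j).1 hj)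
    obtain ⟨y, hyi, hyj, hB⟩ := (hF i).exchange hΔ hH (hF j) hxj hxi
    obtain ⟨k, hk⟩ := hsurj _ hB
    have hki : k < i := by
      rw [hlt, hk, Finset.Colex.toColex_lt_toColex_iff_exists_forall_lt]
      refine ⟨x, by simp, hxi, fun w hw hw' => ?_⟩
      have : w = y := by
        by_contra h
        exact hw' (by simp [h, hw])
      exact this ▸ hmax y hyi hyj
    have hle : σ ⊆ (F i).erase y := fun w hw =>
      Finset.mem_erase.2 ⟨fun h => hyj (h ▸ hσj hw), hσi hw⟩
    have hmem : (F i).erase y ∈ ((generated {F i}).inter (generated (F '' Set.Iio i))).faces :=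
      ⟨⟨F i, rfl, Finset.erase_subset _ _⟩,
        ⟨F k, ⟨k, hki, rfl⟩, hk ▸ Finset.subset_insert _ _⟩⟩
    have hσe : σ = (F i).erase y := hle.antisymm (hσ.le_of_ge hmem hle)
    have hcard := Finset.card_erase_add_one hyi
    rw [hσe, faceDim, faceDim]
    omega

end FaceComplex

/-! ### Directed cycles and elimination of tree conflicts -/

namespace Multidigraph

variable {V E : Type*} {D : Multidigraph V E}

/-- Parallel pairs and pairs with different sources merge into one case, where sources play no role.
-/
theorem mem_treeConflicts {σ : Set E} : σ ∈ D.treeConflicts ↔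
    D.IsDirectedCycle σ ∨ ∃ e f, e ≠ f ∧ D.tgt e = D.tgt f ∧ σ = {e, f} := by
  constructor
  · rintro ((h | ⟨e, f, h, rfl⟩) | ⟨e, f, h1, h2, rfl⟩)
    · exact Or.inl h
    · exact Or.inr ⟨e, f, h.1, h.2.2, rfl⟩
    · exact Or.inr ⟨e, f, fun h => h1 (h ▸ rfl), h2, rfl⟩
  · rintro (h | ⟨e, f, hne, ht, rfl⟩)
    · exact Or.inl (Or.inl h)
    · by_cases hs : D.src e = D.src f
      · exact Or.inl (Or.inr ⟨e, f, ⟨hne, hs, ht⟩, rfl⟩)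
      · exact Or.inr ⟨e, f, hs, ht, rfl⟩

theorem exists_hyperedge_subset [Finite E] {σ : Set E} (hσ : σ ∈ D.treeConflicts) :
    ∃ c ∈ D.treeConflictHypergraph.edgeSet, c ⊆ σ := by
  obtain ⟨c, hcs, hc⟩ := exists_minimal_le_of_wellFoundedLT (· ∈ D.treeConflicts) σ hσ
  exact ⟨c, hc, hcs⟩

theorem isDirectedForest_iff [Finite E] {σ : Set E} :
    D.IsDirectedForest σ ↔ ∀ c ∈ D.treeConflictHypergraph.edgeSet, ¬ c ⊆ σ := by
  constructor
  · rintro ⟨-, h2, h3⟩ c hc hcs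
    rcases mem_treeConflicts.1 hc.prop with h | ⟨e, f, hne, ht, rfl⟩
    · exact h2 c hcs h
    · exact h3 e (hcs (by simp)) f (hcs (by simp)) hne ht
  · intro h
    have h' : ∀ τ ⊆ σ, τ ∉ D.treeConflicts := fun τ hτ hτc => by
      obtain ⟨c, hc, hcs⟩ := exists_hyperedge_subset hτc
      exact h c hc (hcs.trans hτ)
    have hpair : ∀ e ∈ σ, ∀ f ∈ σ, e ≠ f → D.tgt e ≠ D.tgt f := fun e he f hf hne ht =>
      h' {e, f} (Set.pair_subset he hf) (mem_treeConflicts.2 (Or.inr ⟨e, f, hne, ht, rfl⟩))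
    exact ⟨fun e he f hf hef => hpair e he f hf hef.1 hef.2.2,
      fun τ hτ hc => h' τ hτ (mem_treeConflicts.2 (Or.inl hc)), hpair⟩

/-- Replacing the edges of a directed cycle by edges with the same endpoints gives a directed
cycle. -/
theorem IsDirectedCycle.image {σ : Set E} (h : D.IsDirectedCycle σ) (φ : E → E)
    (hs : ∀ e, D.src (φ e) = D.src e) (ht : ∀ e, D.tgt (φ e) = D.tgt e) :
    D.IsDirectedCycle (φ '' σ) := by
  have hv : D.verts (φ '' σ) = D.verts σ := by
    ext v
    simp [verts, hs, ht]
  have hin : ∀ v, {e | e ∈ φ '' σ ∧ D.tgt e = v} = φ '' {e | e ∈ σ ∧ D.tgt e = v} := fun v => by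
    ext e
    constructor
    · rintro ⟨⟨f, hf, rfl⟩, hfv⟩
      exact ⟨f, ⟨hf, ht f ▸ hfv⟩, rfl⟩
    · rintro ⟨f, ⟨hf, hfv⟩, rfl⟩
      exact ⟨⟨f, hf, rfl⟩, (ht f).trans hfv⟩
  have hout : ∀ v, {e | e ∈ φ '' σ ∧ D.src e = v} = φ '' {e | e ∈ σ ∧ D.src e = v} := fun v => by
    ext e
    constructor
    · rintro ⟨⟨f, hf, rfl⟩, hfv⟩
      exact ⟨f, ⟨hf, hs f ▸ hfv⟩, rfl⟩
    · rintro ⟨f, ⟨hf, hfv⟩, rfl⟩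
      exact ⟨⟨f, hf, rfl⟩, (hs f).trans hfv⟩
  refine ⟨?_, ?_, fun v hvm => ?_⟩
  · rintro _ ⟨e, he, rfl⟩ _ ⟨f, hf, rfl⟩ ⟨hne, -, htt⟩
    rw [ht, ht] at htt
    exact hne (congrArg φ (h.eq_of_tgt he hf htt))
  · refine (SimpleGraph.Iso.connected_iff (G := D.underlying σ)
      ⟨Equiv.setCongr hv.symm, fun {a b} => ?_⟩).1 h.2.1
    simp [underlying, hs, ht, Subtype.ext_iff]
  · obtain ⟨h1, h2⟩ := h.2.2 v (hv ▸ hvm)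
    obtain ⟨a, ha⟩ := Set.ncard_eq_one.1 h1
    obtain ⟨b, hb⟩ := Set.ncard_eq_one.1 h2
    rw [inDegree, outDegree, hin, hout, ha, hb]
    simp

/-- Two distinct directed cycles with a common edge contain distinct
edges with a common target. -/
theorem IsDirectedCycle.exists_ne_of_tgt_eq [Finite E]
    {σ τ : Set E} (hσ : D.IsDirectedCycle σ) (hτ : D.IsDirectedCycle τ) (hne : σ ≠ τ) {v : E}
    (hvσ : v ∈ σ) (hvτ : v ∈ τ) : ∃ e ∈ σ, ∃ f ∈ τ, e ≠ f ∧ D.tgt e = D.tgt f := by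
  by_contra! hcon
  have heq : ∀ e ∈ σ, ∀ f ∈ τ, D.tgt e = D.tgt f → e = f := fun e he f hf ht =>
    by_contra fun h => hcon e he f hf h ht
  -- The edges of `σ` and `τ` entering a common vertex coincide, so the predecessor of a common edge
  -- is again common.
  have hsub : D.src '' (σ ∩ τ) ⊆ D.tgt '' (σ ∩ τ) := by
    rintro _ ⟨e, ⟨he, he'⟩, rfl⟩
    obtain ⟨f, hf, hfe⟩ := hσ.exists_tgt ⟨e, he, Or.inl rfl⟩
    obtain ⟨g, hg, hge⟩ := hτ.exists_tgt ⟨e, he', Or.inl rfl⟩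
    have hfg := heq f hf g hg (hfe.trans hge.symm)
    exact ⟨f, ⟨hf, hfg ▸ hg⟩, hfe⟩
  -- Source and target are injective on a cycle, so both images have `|σ ∩ τ|` elements. Hence the
  -- vertices of the common edges are closed under adjacency in `σ`, and connectedness gives `σ ⊆
  -- τ`.
  have hsrc : D.src '' (σ ∩ τ) = D.tgt '' (σ ∩ τ) := by
    refine Set.eq_of_subset_of_ncard_le hsub ?_ (Set.toFinite _)
    rw [Set.InjOn.ncard_image fun e he f hf => hσ.eq_of_tgt he.1 hf.1,
      Set.InjOn.ncard_image fun e he f hf => hσ.eq_of_src he.1 hf.1]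
  have key : ∀ w : D.verts σ, (D.underlying σ).Reachable ⟨D.tgt v, v, hvσ, Or.inr rfl⟩ w →
      (w : V) ∈ D.tgt '' (σ ∩ τ) := by
    intro w hw
    rw [SimpleGraph.reachable_iff_reflTransGen] at hw
    induction hw with
    | refl => exact ⟨v, ⟨hvσ, hvτ⟩, rfl⟩
    | @tail b c _ hbc ih =>
      rw [underlying, SimpleGraph.fromRel_adj] at hbc
      rcases hbc.2 with ⟨e, he, h1, h2⟩ | ⟨e, he, h1, h2⟩
      · obtain ⟨f, hf, hfb⟩ := hsrc ▸ ih
        have hef : e = f := hσ.eq_of_src he hf.1 (h1.trans hfb.symm)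
        exact ⟨f, hf, hef ▸ h2⟩
      · obtain ⟨f, hf, hfb⟩ := ih
        have hef : e = f := hσ.eq_of_tgt he hf.1 (h2.trans hfb.symm)
        exact hsrc ▸ ⟨f, hf, hef ▸ h1⟩
  refine hne (hσ.eq_of_subset hτ fun e he => ?_)
  obtain ⟨f, hf, hfe⟩ := key ⟨D.tgt e, e, he, Or.inr rfl⟩ (hσ.2.1.preconnected _ _)
  exact (hσ.eq_of_tgt hf.1 he hfe) ▸ hf.2

/-- The other edge `g` of the pair is parallel to `v`, since otherwise it would pierce `σ`;
substituting `g` for `v` in `σ` gives a directed cycle avoiding `v`. -/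
theorem pair_union_directedCycle_elimination (hD : ∀ e : E, ¬ D.IsCyclePiercing e) {σ : Set E}
    (hσ : D.IsDirectedCycle σ) {e f v : E} (hne : e ≠ f) (ht : D.tgt e = D.tgt f)
    (hv : v ∈ ({e, f} : Set E)) (hvσ : v ∈ σ) :
    ∃ c ∈ D.treeConflicts, c ⊆ ({e, f} ∪ σ) \ {v} := by
  classical
  obtain ⟨g, hgv, hgt, hg⟩ : ∃ g, g ≠ v ∧ D.tgt g = D.tgt v ∧ g ∈ ({e, f} : Set E) := by
    rcases hv with rfl | rfl
    exacts [⟨f, hne.symm, ht.symm, by simp⟩, ⟨e, hne, ht, by simp⟩]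
  have hgs : D.src g = D.src v := by_contra fun h => hD g ⟨σ, hσ, v, hvσ, hgt, h⟩
  refine ⟨(fun x => if x = v then g else x) '' σ, mem_treeConflicts.2 (Or.inl (hσ.image _ ?_ ?_)), ?_⟩
  · intro x; split_ifs with h
    exacts [h ▸ hgs, rfl]
  · intro x; split_ifs with h
    exacts [h ▸ hgt, rfl]
  · rintro _ ⟨x, hx, rfl⟩
    dsimp only
    split_ifs with h
    exacts [⟨Or.inl hg, hgv⟩, ⟨Or.inr hx, h⟩]

theorem treeConflictHypergraph_hasElimination [Finite E] (hD : ∀ e : E, ¬ D.IsCyclePiercing e) :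
    D.treeConflictHypergraph.HasElimination := by
  intro a ha b hb hab v hva hvb
  suffices h : ∃ c ∈ D.treeConflicts, c ⊆ (a ∪ b) \ {v} by
    obtain ⟨c, hc, hcs⟩ := h
    obtain ⟨d, hd, hdc⟩ := exists_hyperedge_subset hc
    exact ⟨d, hd, hdc.trans hcs⟩
  rcases mem_treeConflicts.1 ha.prop with ha | ⟨e, f, hne, ht, rfl⟩ <;>
    rcases mem_treeConflicts.1 hb.prop with hb | ⟨e', f', hne', ht', rfl⟩
  · obtain ⟨x, hx, y, hy, hxy, ht⟩ := ha.exists_ne_of_tgt_eq hb hab hva hvb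
    -- In each cycle `v` is the only edge with its target, so if `x` or `y` were `v`, both would be.
    have hxv : x ≠ v := fun h => hxy (h ▸ hb.eq_of_tgt hvb hy (h ▸ ht))
    have hyv : y ≠ v := fun h => hxy (ha.eq_of_tgt hx (h ▸ hva) ht)
    exact ⟨{x, y}, mem_treeConflicts.2 (Or.inr ⟨x, y, hxy, ht, rfl⟩),
      Set.pair_subset ⟨Or.inl hx, hxv⟩ ⟨Or.inr hy, hyv⟩⟩
  · rw [Set.union_comm]
    exact pair_union_directedCycle_elimination hD ha hne' ht' hvb hva
  · exact pair_union_directedCycle_elimination hD hb hne ht hva hvb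
  · have hpair : ∀ {e f : E}, e ≠ f → D.tgt e = D.tgt f → v ∈ ({e, f} : Set E) →
        ∃ g, g ≠ v ∧ D.tgt g = D.tgt v ∧ ({e, f} : Set E) = {v, g} := by
      rintro e f hne ht (rfl | rfl)
      exacts [⟨f, hne.symm, ht.symm, rfl⟩, ⟨e, hne, ht, Set.pair_comm _ _⟩]
    obtain ⟨g, hgv, hgt, hg⟩ := hpair hne ht hva
    obtain ⟨k, hkv, hkt, hk⟩ := hpair hne' ht' hvb
    rw [hg, hk] at hab ⊢
    exact ⟨{g, k}, mem_treeConflicts.2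
        (Or.inr ⟨g, k, fun h => hab (h ▸ rfl), hgt.trans hkt.symm, rfl⟩),
      Set.pair_subset ⟨by simp, hgv⟩ ⟨by simp, hkv⟩⟩

end Multidigraph

theorem mainTheorem8 {V E : Type*} [Finite V] [Finite E] (D : Multidigraph V E)
    (hD : ∀ e : E, ¬ D.IsCyclePiercing e) :
    D.treeConflictHypergraph.IsWChordal ∧ D.directedTreeComplex.IsShellable :=
  ⟨(Multidigraph.treeConflictHypergraph_hasElimination hD).isWChordal,
    FaceComplex.isShellable_of_hasElimination (fun _ => Multidigraph.isDirectedForest_iff)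
      (Multidigraph.treeConflictHypergraph_hasElimination hD)⟩
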